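/- Let $n\ge 0$ and $[n]=\{1,\dots,n\}$. A set partition $\pi$ of $[n]$ is noncrossing if, whenever $a<b<c<d$, $a\sim c$ and $b\sim d$ in $\pi$, we have $a\sim b\sim c\sim d$ in $\pi$. Let $\mathrm{NC}(n)$ be the set of noncrossing set partitions of $[n]$ and $\mathbb{C}[\mathrm{NC}(n)]$ the complex vector space with basis $\mathrm{NC}(n)$. For $w\in\mathfrak{S}_n$ and a set partition $\pi$, let $w(\pi)$ be the set partition with blocks $w(B)$, for $B$ a block of $\pi$. Write $s_i=(i,i+1)$ for $1\le i\le n-1$. If $\pi$ is a set partition that is not noncrossing but $s_i(\pi)$ is noncrossing, let $B_i\ni i$ and $B_{i+1}\ni i+1$ be the blocks of $\pi$ containing $i$ and $i+1$; they are distinct and have at least two elements each. Put $$\sigma_i(\pi)=\pi_1+\pi_2-\epsilon_3\,\pi_3-\epsilon_4\,\pi_4\in\mathbb{C}[\mathrm{NC}(n)],$$ where $\epsilon_3=1$ if $|B_i|>2$ and $\epsilon_3=0$ if $|B_i|=2$, where $\epsilon_4=1$ if $|B_{i+1}|>2$ and $\epsilon_4=0$ if $|B_{i+1}|=2$, and where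 $\pi_1,\dots,\pi_4$ are the noncrossing partitions obtained from $\pi$ by replacing the blocks $B_i$, $B_{i+1}$ with $(B_i\setminus\{i\})\cup\{i+1\}$ and $(B_{i+1}\setminus\{i+1\})\cup\{i\}$ for $\pi_1$; $(B_i\cup B_{i+1})\setminus\{i,i+1\}$ and $\{i,i+1\}$ for $\pi_2$; $B_i\setminus\{i\}$ and $B_{i+1}\cup\{i\}$ for $\pi_3$; $B_{i+1}\setminus\{i+1\}$ and $B_i\cup\{i+1\}$ for $\pi_4$. There is a unique linear action of $\mathfrak{S}_n$ on $\mathbb{C}[\mathrm{NC}(n)]$, called the skein action, such that for all $\pi\in\mathrm{NC}(n)$ and $1\le i\le n-1$ $$s_i\cdot\pi=\begin{cases}-s_i(\pi)&\text{if } s_i(\pi) \text{ is noncrossing},\\ \sigma_i(s_i(\pi))&\text{otherwise.}\end{cases}$$ If $w\in\mathfrak{S}_n$ and $\pi\in\mathrm{NC}(n)$ are such that $w(\pi)\in\mathrm{NC}(n)$, then under the skein action $$w\cdot\pi=\mathrm{sign}(w)\,w(\pi).$$ In particular, let $w_0\in\mathfrak{S}_n$ be the long element, $w_0(i)=n-i+1$,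 and, for $n\ge 1$, let $c=(1,2,\dots,n)$ be the long cycle. Then for every $\pi\in\mathrm{NC}(n)$ the partitions $w_0(\pi)$ and $c(\pi)$ are noncrossing, and $$w_0\cdot\pi=(-1)^{\binom n2}\,w_0(\pi),\qquad c\cdot\pi=(-1)^{n-1}\,c(\pi).$$ -/

import Mathlib

namespace Skein

variable {n : ℕ}

/-- A set partition of `{1, …, n}` is modelled as an equivalence relation `π : Setoid (Fin n)`
(index `k + 1` is the element `k` of `Fin n`); its blocks are the equivalence classes.
It is noncrossing if `a < b < c < d`, `a ∼ c` and `b ∼ d` force `a ∼ b ∼ c ∼ d`. -/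
def Noncrossing (π : Setoid (Fin n)) : Prop :=
  ∀ a b c d : Fin n, a < b → b < c → c < d → π a c → π b d → π a b ∧ π b c ∧ π c d

/-- The set `NC(n)` of noncrossing set partitions. -/
abbrev NC (n : ℕ) : Type := {π : Setoid (Fin n) // Noncrossing π}

/-- The block of `π` containing `x`. -/
def block (π : Setoid (Fin n)) (x : Fin n) : Set (Fin n) := {y | π y x}

/-- The set partition `w(π)`, with blocks `w(B)` for `B` a block of `π`. -/
def permute (w : Equiv.Perm (Fin n)) (π : Setoid (Fin n)) : Setoid (Fin n) :=
  Setoid.comap (w⁻¹ : Equiv.Perm (Fin n)) π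

/-- The partition whose blocks are `C`, `D` and the sets `B \ (C ∪ D)` for `B` a block of `π`.
If `C ∪ D = A ∪ B` for two blocks `A`, `B` of `π`, this is the partition obtained from `π` by
replacing `A` and `B` with `C` and `D`. -/
def replaceBlocks (π : Setoid (Fin n)) (C D : Set (Fin n)) (hCD : Disjoint C D) :
    Setoid (Fin n) where
  r x y := (x ∈ C ∧ y ∈ C) ∨ (x ∈ D ∧ y ∈ D) ∨ (x ∉ C ∪ D ∧ y ∉ C ∪ D ∧ π x y)
  iseqv := by
    rw [Set.disjoint_left] at hCD
    refine ⟨fun x => ?_, fun {x y} h => ?_, fun {x y z} h h' => ?_⟩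
    · have := π.refl x
      simp only [Set.mem_union]
      tauto
    · have : π x y → π y x := π.symm
      tauto
    · have : π x y → π y z → π x z := π.trans
      have := @hCD y
      simp only [Set.mem_union] at h h' ⊢
      tauto

/-- The smaller index moved by the adjacent transposition `s_i`. -/
def lo (i : ℕ) (h : i + 1 < n) : Fin n := ⟨i, Nat.lt_of_succ_lt h⟩

/-- The larger index moved by the adjacent transposition `s_i`. -/
def up (i : ℕ) (h : i + 1 < n) : Fin n := ⟨i + 1, h⟩

/-- The adjacent transposition `s_i`. -/
def adj (i : ℕ) (h : i + 1 < n) : Equiv.Perm (Fin n) := Equiv.swap (lo i h) (up i h)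

theorem lo_ne_up (i : ℕ) (h : i + 1 < n) : lo i h ≠ up i h := by
  simp [lo, up]

theorem permute_adj_iff (i : ℕ) (h : i + 1 < n) (π : Setoid (Fin n)) (x y : Fin n) :
    permute (adj i h) π x y ↔ π (adj i h x) (adj i h y) := by
  unfold permute
  rw [Setoid.comap_rel]
  simp [adj]

theorem permute_adj_permute_adj (i : ℕ) (h : i + 1 < n) (π : Setoid (Fin n)) :
    permute (adj i h) (permute (adj i h) π) = π := by
  ext x y
  rw [permute_adj_iff, permute_adj_iff]
  simp [adj]

/-- `π` is almost noncrossing, witnessed by the index `i`. -/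
structure AlmostNoncrossing (i : ℕ) (h : i + 1 < n) (π : Setoid (Fin n)) : Prop where
  crossing : ¬ Noncrossing π
  noncrossing : Noncrossing (permute (adj i h) π)

theorem AlmostNoncrossing.not_rel {i : ℕ} {h : i + 1 < n} {π : Setoid (Fin n)}
    (hπ : AlmostNoncrossing i h π) : ¬ π (lo i h) (up i h) := by
  intro hr
  apply hπ.crossing
  have : permute (adj i h) π = π := by
    have key : ∀ x, π (adj i h x) x := by
      intro x
      unfold adj
      rcases eq_or_ne x (lo i h) with rfl | h1
      · rw [Equiv.swap_apply_left]
        exact π.symm hr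
      · rcases eq_or_ne x (up i h) with rfl | h2
        · rw [Equiv.swap_apply_right]
          exact hr
        · rw [Equiv.swap_apply_of_ne_of_ne h1 h2]
    ext x y
    rw [permute_adj_iff]
    exact ⟨fun e => π.trans (π.symm (key x)) (π.trans e (key y)),
      fun e => π.trans (key x) (π.trans e (π.symm (key y)))⟩
  exact this ▸ hπ.noncrossing








section Resolution

variable {i : ℕ} {h : i + 1 < n} {π : Setoid (Fin n)}

theorem AlmostNoncrossing.disjoint_block (hπ : AlmostNoncrossing i h π) :
    Disjoint (block π (lo i h)) (block π (up i h)) :=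
  Set.disjoint_left.2 fun _ h1 h2 => hπ.not_rel (π.trans (π.symm h1) h2)

theorem AlmostNoncrossing.disjoint₁ (hπ : AlmostNoncrossing i h π) :
    Disjoint ((block π (lo i h) \ {lo i h}) ∪ {up i h})
      ((block π (up i h) \ {up i h}) ∪ {lo i h}) := by
  have h1 := Set.disjoint_left.1 hπ.disjoint_block
  have h2 := lo_ne_up i h
  rw [Set.disjoint_left]
  intro x
  have := @h1 x
  simp only [Set.mem_union, Set.mem_sdiff, Set.mem_singleton_iff]
  grind

theorem AlmostNoncrossing.disjoint₂ (_hπ : AlmostNoncrossing i h π) :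
    Disjoint ((block π (lo i h) ∪ block π (up i h)) \ {lo i h, up i h}) {lo i h, up i h} :=
  Set.disjoint_sdiff_left

theorem AlmostNoncrossing.disjoint₃ (hπ : AlmostNoncrossing i h π) :
    Disjoint (block π (lo i h) \ {lo i h}) (block π (up i h) ∪ {lo i h}) := by
  have h1 := Set.disjoint_left.1 hπ.disjoint_block
  rw [Set.disjoint_left]
  intro x
  have := @h1 x
  simp only [Set.mem_union, Set.mem_sdiff, Set.mem_singleton_iff]
  grind

theorem AlmostNoncrossing.disjoint₄ (hπ : AlmostNoncrossing i h π) :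
    Disjoint (block π (up i h) \ {up i h}) (block π (lo i h) ∪ {up i h}) := by
  have h1 := Set.disjoint_left.1 hπ.disjoint_block
  rw [Set.disjoint_left]
  intro x
  have := @h1 x
  simp only [Set.mem_union, Set.mem_sdiff, Set.mem_singleton_iff]
  grind

/-- `π₁`: the new blocks are `(B_i - {i}) ∪ {i+1}` and `(B_{i+1} - {i+1}) ∪ {i}`. -/
def res₁ (hπ : AlmostNoncrossing i h π) : Setoid (Fin n) :=
  replaceBlocks π ((block π (lo i h) \ {lo i h}) ∪ {up i h})
    ((block π (up i h) \ {up i h}) ∪ {lo i h}) hπ.disjoint₁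

/-- `π₂`: the new blocks are `(B_i ∪ B_{i+1}) - {i, i+1}` and `{i, i+1}`. -/
def res₂ (hπ : AlmostNoncrossing i h π) : Setoid (Fin n) :=
  replaceBlocks π ((block π (lo i h) ∪ block π (up i h)) \ {lo i h, up i h})
    {lo i h, up i h} hπ.disjoint₂

/-- `π₃`: the new blocks are `B_i - {i}` and `B_{i+1} ∪ {i}`. -/
def res₃ (hπ : AlmostNoncrossing i h π) : Setoid (Fin n) :=
  replaceBlocks π (block π (lo i h) \ {lo i h}) (block π (up i h) ∪ {lo i h}) hπ.disjoint₃

/-- `π₄`: the new blocks are `B_{i+1} - {i+1}` and `B_i ∪ {i+1}`. -/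
def res₄ (hπ : AlmostNoncrossing i h π) : Setoid (Fin n) :=
  replaceBlocks π (block π (up i h) \ {up i h}) (block π (lo i h) ∪ {up i h}) hπ.disjoint₄

/-- A noncrossing partition pulled back along a monotone map is noncrossing. -/
theorem Noncrossing.comap {μ : Setoid (Fin n)} (hμ : Noncrossing μ) {f : Fin n → Fin n}
    (hf : Monotone f) : Noncrossing (Setoid.comap f μ) := by
  intro a b c d hab hbc hcd hac hbd
  rw [Setoid.comap_rel] at hac hbd ⊢
  suffices hs : μ (f a) (f b) from
    ⟨hs, μ.trans (μ.symm hs) hac, μ.trans (μ.symm hac) (μ.trans hs hbd)⟩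
  rcases (hf hab.le).eq_or_lt with e | h1
  · rw [e]
  rcases (hf hbc.le).eq_or_lt with e | h2
  · rw [e]; exact hac
  rcases (hf hcd.le).eq_or_lt with e | h3
  · exact μ.trans hac (e ▸ μ.symm hbd)
  exact (hμ _ _ _ _ h1 h2 h3 hac hbd).1

theorem adj_lo : adj i h (lo i h) = up i h := Equiv.swap_apply_left _ _

theorem adj_up : adj i h (up i h) = lo i h := Equiv.swap_apply_right _ _

theorem adj_of_ne {x : Fin n} (h1 : x ≠ lo i h) (h2 : x ≠ up i h) : adj i h x = x :=
  Equiv.swap_apply_of_ne_of_ne h1 h2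

theorem replaceBlocks_iff (C D : Set (Fin n)) (hCD : Disjoint C D) (x y : Fin n) :
    replaceBlocks π C D hCD x y ↔
      (x ∈ C ∧ y ∈ C) ∨ (x ∈ D ∧ y ∈ D) ∨ (x ∉ C ∪ D ∧ y ∉ C ∪ D ∧ π x y) := Iff.rfl

theorem mem_block {x y : Fin n} : y ∈ block π x ↔ π y x := Iff.rfl

/-- `π₁` is the partition `s_i(π)`. -/
theorem res₁_eq (hπ : AlmostNoncrossing i h π) : res₁ hπ = permute (adj i h) π := by
  have h0 := lo_ne_up i h
  have hn := hπ.not_rel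
  have hr : ∀ x, π x x := fun x => π.refl x
  have hs : ∀ x y, π x y → π y x := fun x y => π.symm
  have ht : ∀ x y z, π x y → π y z → π x z := fun x y z => π.trans
  ext x y
  rw [permute_adj_iff]
  unfold res₁
  rw [replaceBlocks_iff]
  simp only [Set.mem_union, Set.mem_sdiff, Set.mem_singleton_iff, mem_block]
  by_cases hx1 : x = lo i h <;> by_cases hx2 : x = up i h <;>
  by_cases hy1 : y = lo i h <;> by_cases hy2 : y = up i h <;>
  simp only [hx1, hx2, hy1, hy2, adj_lo, adj_up, adj_of_ne, ne_eq, not_false_eq_true] <;>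
  grind

theorem res₁_noncrossing (hπ : AlmostNoncrossing i h π) : Noncrossing (res₁ hπ) :=
  res₁_eq hπ ▸ hπ.noncrossing

theorem res₂_noncrossing (hπ : AlmostNoncrossing i h π) : Noncrossing (res₂ hπ) := by
  have h0 := lo_ne_up i h
  have hn := hπ.not_rel
  have hr : ∀ x, π x x := fun x => π.refl x
  have hs : ∀ x y, π x y → π y x := fun x y => π.symm
  have ht : ∀ x y z, π x y → π y z → π x z := fun x y z => π.trans
  have hN : ∀ a b c d : Fin n, a < b → b < c → c < d →
      π (adj i h a) (adj i h c) → π (adj i h b) (adj i h d) → π (adj i h a) (adj i h b) := by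
    intro a b c d h1 h2 h3 h4 h5
    exact ((permute_adj_iff i h π a b).1
      (hπ.noncrossing a b c d h1 h2 h3 ((permute_adj_iff i h π a c).2 h4)
        ((permute_adj_iff i h π b d).2 h5)).1)
  have hbet : ∀ x : Fin n, lo i h < x → x < up i h → False := by
    intro x h1 h2
    simp only [lo, up, Fin.lt_def] at h1 h2
    omega
  have hlt : lo i h < up i h := by simp [lo, up, Fin.lt_def]
  have hiff : ∀ x y, res₂ hπ x y ↔
      ((x ≠ lo i h ∧ x ≠ up i h) ∧ (y ≠ lo i h ∧ y ≠ up i h) ∧ (π x y ∨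
        ((π x (lo i h) ∨ π x (up i h)) ∧ (π y (lo i h) ∨ π y (up i h))))) ∨
      ((x = lo i h ∨ x = up i h) ∧ (y = lo i h ∨ y = up i h)) := by
    intro x y
    unfold res₂
    rw [replaceBlocks_iff]
    simp only [Set.mem_union, Set.mem_sdiff, Set.mem_singleton_iff, Set.mem_insert_iff, mem_block]
    have hx := ht x y (lo i h)
    have hx' := ht x y (up i h)
    have hy := ht y x (lo i h)
    have hy' := ht y x (up i h)
    have hxy := hs x y
    clear hN hbet hr hs ht hn hπ h0 hlt
    by_cases hx0 : x = lo i h ∨ x = up i h <;> by_cases hy0 : y = lo i h ∨ y = up i h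
    · simp [hx0, hy0]
    · rw [not_or] at hy0
      simp only [hx0, hy0, or_self, and_false, or_false, not_true_eq_false,
        not_false_eq_true, and_true]
      simp
      exact fun h1 h2 => absurd hx0 (not_or.2 ⟨h1, h2⟩)
    · rw [not_or] at hx0
      simp only [hx0, hy0, or_self, and_false, or_false, not_true_eq_false,
        not_false_eq_true, and_true]
      simp
      exact fun _ _ h1 h2 => absurd hy0 (not_or.2 ⟨h1, h2⟩)
    · rw [not_or] at hx0 hy0
      obtain ⟨hx1, hx2⟩ := hx0
      obtain ⟨hy1, hy2⟩ := hy0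
      simp only [hx1, hx2, hy1, hy2, ne_eq, not_false_eq_true, true_and, and_true, or_false,
        false_or, and_self]
      generalize π x y = P at *
      generalize π y x = P' at *
      generalize π x (lo i h) = Q at *
      generalize π x (up i h) = Q' at *
      generalize π y (lo i h) = R at *
      generalize π y (up i h) = R' at *
      grind
  have hout : ∀ b d : Fin n, b ≠ lo i h → b ≠ up i h → d ≠ lo i h → d ≠ up i h → b < d →
      ((b < lo i h ∧ lo i h < d ∧ b < up i h ∧ up i h < d) ∨
       (lo i h < b ∧ up i h < b) ∨ (d < lo i h ∧ d < up i h)) := by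
    intro b d h1 h2 h3 h4 h5
    simp only [lo, up, Fin.lt_def, ne_eq, Fin.ext_iff] at h1 h2 h3 h4 h5 ⊢
    omega
  have hmem : ∀ x, (π x (lo i h) ∨ π x (up i h)) →
      ∃ e, (e = lo i h ∨ e = up i h) ∧ π x (adj i h e) := by
    rintro x (hx | hx)
    · exact ⟨up i h, Or.inr rfl, by rw [adj_up]; exact hx⟩
    · exact ⟨lo i h, Or.inl rfl, by rw [adj_lo]; exact hx⟩
  have hmem' : ∀ x e, (e = lo i h ∨ e = up i h) → π x (adj i h e) →
      (π x (lo i h) ∨ π x (up i h)) := by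
    rintro x e (rfl | rfl) hx
    · rw [adj_lo] at hx; exact Or.inr hx
    · rw [adj_up] at hx; exact Or.inl hx
  have hmain : ∀ a b c d : Fin n, (a ≠ lo i h ∧ a ≠ up i h) → (b ≠ lo i h ∧ b ≠ up i h) →
      (c ≠ lo i h ∧ c ≠ up i h) → (d ≠ lo i h ∧ d ≠ up i h) → a < b → b < c → c < d →
      (π a (lo i h) ∨ π a (up i h)) → (π c (lo i h) ∨ π c (up i h)) → π b d →
      (π b (lo i h) ∨ π b (up i h)) := by
    intro a b c d ha hb hc hd hab hbc hcd hma hmc hbd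
    obtain ⟨e, he, hae⟩ := hmem a hma
    obtain ⟨e', he', hce⟩ := hmem c hmc
    rcases hout b d hb.1 hb.2 hd.1 hd.2 (hbc.trans hcd) with ho | ho | ho
    · have h1 : b < e := by rcases he with rfl | rfl <;> simp only [ho]
      have h2 : e < d := by rcases he with rfl | rfl <;> simp only [ho]
      have h3 := hN a b e d hab h1 h2
      rw [adj_of_ne ha.1 ha.2, adj_of_ne hb.1 hb.2, adj_of_ne hd.1 hd.2] at h3
      exact hmem' b e he (ht _ _ _ (hs _ _ (h3 hae hbd)) hae)
    · have h1 : e' < b := by rcases he' with rfl | rfl <;> simp only [ho]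
      have h3 := hN e' b c d h1 hbc hcd
      rw [adj_of_ne hc.1 hc.2, adj_of_ne hb.1 hb.2, adj_of_ne hd.1 hd.2] at h3
      exact hmem' b e' he' (hs _ _ (h3 (hs _ _ hce) hbd))
    · have h1 : d < e' := by rcases he' with rfl | rfl <;> simp only [ho]
      have h3 := hN b c d e' hbc hcd h1
      rw [adj_of_ne hc.1 hc.2, adj_of_ne hb.1 hb.2, adj_of_ne hd.1 hd.2] at h3
      exact hmem' b e' he' (ht _ _ _ (h3 hbd hce) hce)
  have hmain' : ∀ a b c d : Fin n, (a ≠ lo i h ∧ a ≠ up i h) → (b ≠ lo i h ∧ b ≠ up i h) →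
      (c ≠ lo i h ∧ c ≠ up i h) → (d ≠ lo i h ∧ d ≠ up i h) → a < b → b < c → c < d →
      (π b (lo i h) ∨ π b (up i h)) → (π d (lo i h) ∨ π d (up i h)) → π a c →
      (π a (lo i h) ∨ π a (up i h)) := by
    intro a b c d ha hb hc hd hab hbc hcd hmb hmd hac
    obtain ⟨e, he, hbe⟩ := hmem b hmb
    obtain ⟨e', he', hde⟩ := hmem d hmd
    rcases hout a c ha.1 ha.2 hc.1 hc.2 (hab.trans hbc) with ho | ho | ho
    · have h1 : a < e' := by rcases he' with rfl | rfl <;> simp only [ho]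
      have h2 : e' < c := by rcases he' with rfl | rfl <;> simp only [ho]
      have h3 := hN a e' c d h1 h2 hcd
      rw [adj_of_ne ha.1 ha.2, adj_of_ne hc.1 hc.2, adj_of_ne hd.1 hd.2] at h3
      exact hmem' a e' he' (h3 hac (hs _ _ hde))
    · have h1 : e < a := by rcases he with rfl | rfl <;> simp only [ho]
      have h3 := hN e a b c h1 hab hbc
      rw [adj_of_ne ha.1 ha.2, adj_of_ne hb.1 hb.2, adj_of_ne hc.1 hc.2] at h3
      exact hmem' a e he (hs _ _ (h3 (hs _ _ hbe) hac))
    · have h1 : c < e := by rcases he with rfl | rfl <;> simp only [ho]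
      have h3 := hN a b c e hab hbc h1
      rw [adj_of_ne ha.1 ha.2, adj_of_ne hb.1 hb.2, adj_of_ne hc.1 hc.2] at h3
      exact hmem' a e he (ht _ _ _ (h3 hac hbe) hbe)
  intro a b c d hab hbc hcd hac hbd
  suffices hq : res₂ hπ a b from
    ⟨hq, (res₂ hπ).trans ((res₂ hπ).symm hq) hac,
      (res₂ hπ).trans ((res₂ hπ).symm hac) ((res₂ hπ).trans hq hbd)⟩
  rw [hiff] at hac hbd ⊢
  rcases hac with ⟨ha, hc, hac⟩ | hac
  · rcases hbd with ⟨hb, hd, hbd⟩ | hbd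
    · refine Or.inl ⟨ha, hb, ?_⟩
      have e1 := hmain a b c d ha hb hc hd hab hbc hcd
      have e2 := hmain' a b c d ha hb hc hd hab hbc hcd
      have e3 := hN a b c d hab hbc hcd
      rw [adj_of_ne ha.1 ha.2, adj_of_ne hb.1 hb.2, adj_of_ne hc.1 hc.2,
        adj_of_ne hd.1 hd.2] at e3
      rcases hac with hac | hac
      · rcases hbd with hbd | hbd
        · exact Or.inl (e3 hac hbd)
        · exact Or.inr ⟨e2 hbd.1 hbd.2 hac, hbd.1⟩
      · rcases hbd with hbd | hbd
        · exact Or.inr ⟨hac.1, e1 hac.1 hac.2 hbd⟩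
        · exact Or.inr ⟨hac.1, hbd.1⟩
    · exfalso
      have := hbet c
      rcases hbd with ⟨rfl | rfl, rfl | rfl⟩
      · exact absurd (hbc.trans hcd) (lt_irrefl _)
      · exact this hbc hcd
      · exact absurd (hlt.trans (hbc.trans hcd)) (lt_irrefl _)
      · exact absurd (hbc.trans hcd) (lt_irrefl _)
  · exfalso
    have := hbet b
    rcases hac with ⟨rfl | rfl, rfl | rfl⟩
    · exact absurd (hab.trans hbc) (lt_irrefl _)
    · exact this hab hbc
    · exact absurd (hlt.trans (hab.trans hbc)) (lt_irrefl _)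
    · exact absurd (hab.trans hbc) (lt_irrefl _)

theorem res₃_noncrossing (hπ : AlmostNoncrossing i h π) : Noncrossing (res₃ hπ) := by
  have h0 := lo_ne_up i h
  have hn := hπ.not_rel
  have hr : ∀ x, π x x := fun x => π.refl x
  have hs : ∀ x y, π x y → π y x := fun x y => π.symm
  have ht : ∀ x y z, π x y → π y z → π x z := fun x y z => π.trans
  have hf : Monotone fun x : Fin n => if x = up i h then lo i h else x := by
    intro x y hxy
    simp only [lo, up, Fin.le_def, Fin.ext_iff] at *
    split_ifs <;> simp_all <;> omega
  have key : res₃ hπ = Setoid.comap (fun x : Fin n => if x = up i h then lo i h else x)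
      (permute (adj i h) π) := by
    ext x y
    have hc : ∀ ν : Setoid (Fin n),
        Setoid.comap (fun x : Fin n => if x = up i h then lo i h else x) ν x y ↔
        ν (if x = up i h then lo i h else x) (if y = up i h then lo i h else y) :=
      fun _ => Iff.rfl
    rw [hc, permute_adj_iff]
    unfold res₃
    rw [replaceBlocks_iff]
    simp only [Set.mem_union, Set.mem_sdiff, Set.mem_singleton_iff, mem_block]
    by_cases hx1 : x = lo i h <;> by_cases hx2 : x = up i h <;>
    by_cases hy1 : y = lo i h <;> by_cases hy2 : y = up i h <;>
    simp only [hx1, hx2, hy1, hy2, adj_lo, adj_of_ne, ne_eq, not_false_eq_true,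
      if_true, if_false] <;>
    grind [adj_lo, adj_up, adj_of_ne]
  rw [key]
  exact hπ.noncrossing.comap hf

theorem res₄_noncrossing (hπ : AlmostNoncrossing i h π) : Noncrossing (res₄ hπ) := by
  have h0 := lo_ne_up i h
  have hn := hπ.not_rel
  have hr : ∀ x, π x x := fun x => π.refl x
  have hs : ∀ x y, π x y → π y x := fun x y => π.symm
  have ht : ∀ x y z, π x y → π y z → π x z := fun x y z => π.trans
  have hf : Monotone fun x : Fin n => if x = lo i h then up i h else x := by
    intro x y hxy
    simp only [lo, up, Fin.le_def, Fin.ext_iff] at *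
    split_ifs <;> simp_all <;> omega
  have key : res₄ hπ = Setoid.comap (fun x : Fin n => if x = lo i h then up i h else x)
      (permute (adj i h) π) := by
    ext x y
    have hc : ∀ ν : Setoid (Fin n),
        Setoid.comap (fun x : Fin n => if x = lo i h then up i h else x) ν x y ↔
        ν (if x = lo i h then up i h else x) (if y = lo i h then up i h else y) :=
      fun _ => Iff.rfl
    rw [hc, permute_adj_iff]
    unfold res₄
    rw [replaceBlocks_iff]
    simp only [Set.mem_union, Set.mem_sdiff, Set.mem_singleton_iff, mem_block]
    by_cases hx1 : x = lo i h <;> by_cases hx2 : x = up i h <;>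
    by_cases hy1 : y = lo i h <;> by_cases hy2 : y = up i h <;>
    simp only [hx1, hx2, hy1, hy2, adj_up, adj_of_ne, ne_eq, not_false_eq_true,
      if_true, if_false] <;>
    grind [adj_lo, adj_up, adj_of_ne]
  rw [key]
  exact hπ.noncrossing.comap hf

end Resolution

noncomputable section

/-- The basis vector of `ℂ[NC(n)]` indexed by a noncrossing partition. -/
abbrev basisVec (π : Setoid (Fin n)) (hπ : Noncrossing π) : NC n →₀ ℂ :=
  Finsupp.single ⟨π, hπ⟩ 1

/-- The resolution `σ(π)` of an almost noncrossing partition `π` with `s_i(π)` noncrossing: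
`π₁ + π₂`, minus `π₃` when `|B_i| > 2`, minus `π₄` when `|B_{i+1}| > 2`
(otherwise the block in question has exactly two elements). -/
def sigma {i : ℕ} {h : i + 1 < n} {π : Setoid (Fin n)} (hπ : AlmostNoncrossing i h π) :
    NC n →₀ ℂ :=
  basisVec (res₁ hπ) (res₁_noncrossing hπ) + basisVec (res₂ hπ) (res₂_noncrossing hπ)
    - (if 2 < (block π (lo i h)).ncard then basisVec (res₃ hπ) (res₃_noncrossing hπ) else 0)
    - (if 2 < (block π (up i h)).ncard then basisVec (res₄ hπ) (res₄_noncrossing hπ) else 0)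

theorem almostNoncrossing_permute (i : ℕ) (h : i + 1 < n) (π : NC n)
    (hc : ¬ Noncrossing (permute (adj i h) π.1)) :
    AlmostNoncrossing i h (permute (adj i h) π.1) :=
  ⟨hc, by rw [permute_adj_permute_adj]; exact π.2⟩

open Classical in
/-- The vector `s_i · π` of `ℂ[NC(n)]`, for `π` noncrossing. -/
def adjAct (i : ℕ) (h : i + 1 < n) (π : NC n) : NC n →₀ ℂ :=
  if hs : Noncrossing (permute (adj i h) π.1) then - basisVec (permute (adj i h) π.1) hs
  else sigma (almostNoncrossing_permute i h π hs)

/-- `ρ` is the skein action: the representation of the symmetric group on `ℂ[NC(n)]` in which the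
adjacent transpositions act on the basis `NC(n)` by the skein rule. -/
def IsSkeinAction (ρ : Representation ℂ (Equiv.Perm (Fin n)) (NC n →₀ ℂ)) : Prop :=
  ∀ (i : ℕ) (h : i + 1 < n) (π : NC n), ρ (adj i h) (basisVec π.1 π.2) = adjAct i h π

end

end Skein

/-! The skein action becomes transparent after embedding `ℂ[NC(n)]` in a space where permutations
act by relabelling twisted by the sign. Every set partition `π`, crossing or not, gets a vector
`partitionVec π`, a function of two point sequences `t`, `x`. Its value is the determinant of the
matrix of relations `t a ∼ x b` when both sequences have as many terms as `π` has blocks and their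
common points are exactly the singletons of `π`; otherwise it is zero. Relabelling `π` by `w`
relabels the sequences, whence `signedPullRep`.

Two facts carry the proof. First, `partitionVec_skein`: the combination `σ_i(π)` has vector
`-partitionVec π`. The determinant factors as a product of two incidence determinants, and the
resolutions alter only two rows of each, so this is an identity between alternating bilinear forms,
`detRows_skein`. Second, `skeinMap_injective`: the vectors of noncrossing partitions are linearly
independent. The block minima and maxima of a noncrossing partition determine it
(`Noncrossing.eq_of_lowest`), and probing with them gives a triangular system.

By the first fact, the span of the noncrossing vectors is stable under the signed action, and each
`s_i` acts on it by the skein rule. By the second, this action transports back to `ℂ[NC(n)]`. Any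
skein action is intertwined with the signed one by `skeinMap`, which gives both uniqueness and `w ·
π = sign(w) w(π)` whenever `w(π)` is noncrossing. -/

namespace Skein

open Matrix

/-! ### Incidence determinants and the two-row skein identity. -/

section Determinant

variable {k n : ℕ}

/-- The incidence matrix between the fibres of `f` and the sequence of points `t`. -/
def incid (f : Fin n → Fin k) (t : Fin k → Fin n) : Matrix (Fin k) (Fin k) ℂ :=
  Matrix.of fun r c => if f (t c) = r then 1 else 0

/-- Two points have the same colour iff they share some colour `r`; summing over `r` writes the
matrix as a product of an incidence matrix transposed and another. The left side depends only on the
fibres, so the numbering of the colours is irrelevant. -/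
theorem det_fiber_eq_mul (f : Fin n → Fin k) (t x : Fin k → Fin n) :
    (Matrix.of fun a b => if f (t a) = f (x b) then (1 : ℂ) else 0).det =
      (incid f t).det * (incid f x).det := by
  rw [← det_transpose (incid f t), ← det_mul]
  congr 1
  ext a b
  simp [Matrix.mul_apply, incid, eq_comm]

theorem det_incid_eq_zero (f : Fin n → Fin k) (t : Fin k → Fin n) (r : Fin k)
    (hr : ∀ c, f (t c) ≠ r) : (incid f t).det = 0 :=
  det_eq_zero_of_row_eq_zero r fun c => by simp [incid, hr c]

/-- The determinant of `M` with rows `p` and `q` replaced by `v` and `w`. -/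
def detRows (M : Matrix (Fin k) (Fin k) ℂ) (p q : Fin k) (v w : Fin k → ℂ) : ℂ :=
  ((M.updateRow p v).updateRow q w).det

variable {M : Matrix (Fin k) (Fin k) ℂ} {p q : Fin k}

theorem detRows_add_right (v w w' : Fin k → ℂ) :
    detRows M p q v (w + w') = detRows M p q v w + detRows M p q v w' :=
  det_updateRow_add _ _ _ _

theorem detRows_add_left (hpq : p ≠ q) (v v' w : Fin k → ℂ) :
    detRows M p q (v + v') w = detRows M p q v w + detRows M p q v' w := by
  simp only [detRows, updateRow_comm _ hpq]
  exact det_updateRow_add _ _ _ _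

theorem detRows_self (hpq : p ≠ q) (v : Fin k → ℂ) : detRows M p q v v = 0 :=
  det_zero_of_row_eq hpq (by
    rw [updateRow_self, updateRow_ne hpq, updateRow_self])

theorem detRows_swap (hpq : p ≠ q) (v w : Fin k → ℂ) :
    detRows M p q w v = - detRows M p q v w := by
  have h := detRows_self (M := M) hpq (v + w)
  rw [detRows_add_left hpq, detRows_add_right, detRows_add_right, detRows_self hpq,
    detRows_self hpq] at h
  linear_combination h

theorem detRows_zero_right (v : Fin k → ℂ) : detRows M p q v 0 = 0 := by
  have h := detRows_add_right (M := M) (p := p) (q := q) v 0 0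
  rw [add_zero] at h
  linear_combination -h

theorem detRows_zero_left (hpq : p ≠ q) (v : Fin k → ℂ) : detRows M p q 0 v = 0 := by
  rw [detRows_swap hpq, detRows_zero_right, neg_zero]

/-- Expand both alternating forms. Products in which `i` or `j` enters both factors vanish by `hi`
and `hj`; the others cancel by antisymmetry. -/
theorem detRows_skein (N : Matrix (Fin k) (Fin k) ℂ) (hpq : p ≠ q)
    (a b i j a' b' i' j' : Fin k → ℂ) (hi : i = 0 ∨ i' = 0) (hj : j = 0 ∨ j' = 0) :
    detRows M p q (a + i) (b + j) * detRows N p q (a' + i') (b' + j')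
      + detRows M p q (a + j) (b + i) * detRows N p q (a' + j') (b' + i')
      + detRows M p q (a + b) (i + j) * detRows N p q (a' + b') (i' + j')
      - detRows M p q a (b + i + j) * detRows N p q a' (b' + i' + j')
      - detRows M p q (a + i + j) b * detRows N p q (a' + i' + j') b' = 0 := by
  have s : ∀ (M : Matrix (Fin k) (Fin k) ℂ) v w, detRows M p q w v = - detRows M p q v w :=
    fun M => detRows_swap hpq
  simp only [detRows_add_left hpq, detRows_add_right]
  rw [s M b i, s M b j, s M i j, s N b' i', s N b' j', s N i' j']
  rcases hi with rfl | rfl <;> rcases hj with rfl | rfl <;>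
    simp only [detRows_zero_left hpq, detRows_zero_right] <;> ring

/-- A recolouring that moves points only between the colours `p` and `q` changes only two rows. -/
theorem incid_eq_updateRow {f g : Fin n → Fin k} (t : Fin k → Fin n)
    (hfg : ∀ z r, r ≠ p → r ≠ q → (g z = r ↔ f z = r)) (hpq : p ≠ q) {v w : Fin k → ℂ}
    (hv : ∀ c, v c = if g (t c) = p then 1 else 0)
    (hw : ∀ c, w c = if g (t c) = q then 1 else 0) :
    (incid g t).det = detRows (incid f t) p q v w := by
  unfold detRows
  congr 1
  ext r c
  by_cases h1 : r = q
  · subst h1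
    rw [updateRow_self, hw]
    rfl
  rw [updateRow_ne h1]
  by_cases h2 : r = p
  · subst h2
    rw [updateRow_self, hv]
    rfl
  rw [updateRow_ne h2]
  simp only [incid, Matrix.of_apply, hfg (t c) r h2 h1]

/-- The points `i` and `j` exchange their colours. -/
def colour₁ (f : Fin n → Fin k) (i j : Fin n) (z : Fin n) : Fin k :=
  if z = i then f j else if z = j then f i else f z

/-- The points `i` and `j` form a fibre, and their old fibres are merged. -/
def colour₂ (f : Fin n → Fin k) (i j : Fin n) (z : Fin n) : Fin k :=
  if z = i ∨ z = j then f j else if f z = f j then f i else f z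

/-- The point `i` takes the colour of `j`. -/
def colour₃ (f : Fin n → Fin k) (i j : Fin n) (z : Fin n) : Fin k :=
  if z = i then f j else f z

/-- The product of the incidence determinants of two sequences of points. -/
def probeDet (t x : Fin k → Fin n) (f : Fin n → Fin k) : ℂ :=
  (incid f t).det * (incid f x).det

theorem probeDet_skein (t x : Fin k → Fin n) (f : Fin n → Fin k) {i j : Fin n}
    (hij : f i ≠ f j) (hi : (∀ c, t c ≠ i) ∨ ∀ c, x c ≠ i) (hj : (∀ c, t c ≠ j) ∨ ∀ c, x c ≠ j) :
    probeDet t x f + probeDet t x (colour₁ f i j) + probeDet t x (colour₂ f i j)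
      - probeDet t x (colour₃ f i j) - probeDet t x (colour₃ f j i) = 0 := by
  -- `A`, `B` are the rows of the two fibres without `i`, `j`; `I`, `J` are the rows of these
  -- points. The two affected rows of every resolution are sums of these four.
  let A : (Fin k → Fin n) → Fin k → ℂ := fun t c => if f (t c) = f i ∧ t c ≠ i then 1 else 0
  let B : (Fin k → Fin n) → Fin k → ℂ := fun t c => if f (t c) = f j ∧ t c ≠ j then 1 else 0
  let I : (Fin k → Fin n) → Fin k → ℂ := fun t c => if t c = i then 1 else 0
  let J : (Fin k → Fin n) → Fin k → ℂ := fun t c => if t c = j then 1 else 0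
  have hne : i ≠ j := fun h => hij (h ▸ rfl)
  have hij' := hij.symm
  have key : ∀ (g : Fin n → Fin k) (t : Fin k → Fin n) {v w : Fin k → ℂ},
      (∀ z r, r ≠ f i → r ≠ f j → (g z = r ↔ f z = r)) →
      (∀ c, v c = if g (t c) = f i then 1 else 0) →
      (∀ c, w c = if g (t c) = f j then 1 else 0) →
      (incid g t).det = detRows (incid f t) (f i) (f j) v w :=
    fun g t _ _ h hv hw => incid_eq_updateRow t h hij hv hw
  have e0 : ∀ t, (incid f t).det =
      detRows (incid f t) (f i) (f j) (A t + I t) (B t + J t) := fun t =>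
    key f t (fun _ _ _ _ => Iff.rfl) (by intro c; simp only [A, I, Pi.add_apply]; grind)
      (by intro c; simp only [B, J, Pi.add_apply]; grind)
  have e1 : ∀ t, (incid (colour₁ f i j) t).det =
      detRows (incid f t) (f i) (f j) (A t + J t) (B t + I t) := fun t =>
    key _ t (by intro z r; unfold colour₁; grind)
      (by intro c; simp only [A, J, Pi.add_apply, colour₁]; grind)
      (by intro c; simp only [B, I, Pi.add_apply, colour₁]; grind)
  have e2 : ∀ t, (incid (colour₂ f i j) t).det =
      detRows (incid f t) (f i) (f j) (A t + B t) (I t + J t) := fun t =>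
    key _ t (by intro z r; unfold colour₂; grind)
      (by intro c; simp only [A, B, Pi.add_apply, colour₂]; grind)
      (by intro c; simp only [J, I, Pi.add_apply, colour₂]; grind)
  have e3 : ∀ t, (incid (colour₃ f i j) t).det =
      detRows (incid f t) (f i) (f j) (A t) (B t + I t + J t) := fun t =>
    key _ t (by intro z r; unfold colour₃; grind)
      (by intro c; simp only [A, colour₃]; grind)
      (by intro c; simp only [B, I, J, Pi.add_apply, colour₃]; grind)
  have e4 : ∀ t, (incid (colour₃ f j i) t).det =
      detRows (incid f t) (f i) (f j) (A t + I t + J t) (B t) := fun t =>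
    key _ t (by intro z r; unfold colour₃; grind)
      (by intro c; simp only [A, I, J, Pi.add_apply, colour₃]; grind)
      (by intro c; simp only [B, colour₃]; grind)
  unfold probeDet
  rw [e0, e0, e1, e1, e2, e2, e3, e3, e4, e4]
  refine detRows_skein _ hij _ _ _ _ _ _ _ _ ?_ ?_
  · exact hi.imp (fun h => funext fun c => by simp [I, h c]) fun h =>
      funext fun c => by simp [I, h c]
  · exact hj.imp (fun h => funext fun c => by simp [J, h c]) fun h =>
      funext fun c => by simp [J, h c]

end Determinant

end Skein
namespace Skein

/-! ### The vector of a set partition and its equivariance. -/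

section Vectors

variable {n : ℕ}

/-- A pair of sequences of `k` points of `Fin n`. -/
abbrev Probe (n : ℕ) : Type := Σ k : ℕ, (Fin k → Fin n) × (Fin k → Fin n)

/-- `y` is a singleton block of `π`. -/
def IsSingleton (π : Setoid (Fin n)) (y : Fin n) : Prop := ∀ z, π z y → z = y

/-- A pair of sequences, of length the number of blocks of `π`, whose common points are exactly the
singleton blocks of `π`. -/
def Admissible (π : Setoid (Fin n)) (P : Probe n) : Prop :=
  Nat.card (Quotient π) = P.1 ∧
    ∀ y, (y ∈ Set.range P.2.1 ∧ y ∈ Set.range P.2.2) ↔ IsSingleton π y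

open Classical in
/-- The vector attached to a set partition: its coordinate at a pair of sequences `t`, `x` is the
determinant of the `0/1` matrix with entries `t a ∼ x b`. -/
noncomputable def partitionVec (π : Setoid (Fin n)) (P : Probe n) : ℂ :=
  if Admissible π P then
    (Matrix.of fun a b => if π (P.2.1 a) (P.2.2 b) then (1 : ℂ) else 0).det
  else 0

theorem exists_colouring (π : Setoid (Fin n)) :
    ∃ f : Fin n → Fin (Nat.card (Quotient π)), Function.Surjective f ∧ ∀ x y, π x y ↔ f x = f y := by
  refine ⟨fun x => Finite.equivFin (Quotient π) (Quotient.mk π x),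
    (Finite.equivFin _).surjective.comp Quotient.mk_surjective, fun x y => ?_⟩
  rw [(Finite.equivFin (Quotient π)).injective.eq_iff, Quotient.eq]

theorem card_quotient_of_colouring {k : ℕ} {π : Setoid (Fin n)} {f : Fin n → Fin k}
    (hf : Function.Surjective f) (h : ∀ x y, π x y ↔ f x = f y) : Nat.card (Quotient π) = k := by
  have : π = Setoid.ker f := Setoid.ext fun x y => h x y
  rw [this, Nat.card_congr (Setoid.quotientKerEquivOfSurjective f hf), Nat.card_fin]

open Classical in
theorem partitionVec_of_colouring {k : ℕ} {π : Setoid (Fin n)} {f : Fin n → Fin k}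
    (h : ∀ x y, π x y ↔ f x = f y) (t x : Fin k → Fin n) :
    partitionVec π ⟨k, t, x⟩ = if Admissible π ⟨k, t, x⟩ then probeDet t x f else 0 := by
  unfold partitionVec probeDet
  simp only [h, ← det_fiber_eq_mul]

theorem permute_iff (w : Equiv.Perm (Fin n)) (π : Setoid (Fin n)) (x y : Fin n) :
    permute w π x y ↔ π (w⁻¹ x) (w⁻¹ y) := Iff.rfl

theorem card_quotient_permute (w : Equiv.Perm (Fin n)) (π : Setoid (Fin n)) :
    Nat.card (Quotient (permute w π)) = Nat.card (Quotient π) := by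
  obtain ⟨f, hf, h⟩ := exists_colouring π
  exact card_quotient_of_colouring (f := f ∘ (w⁻¹ : Equiv.Perm (Fin n)))
    (hf.comp (Equiv.surjective _)) fun x y => h _ _

theorem isSingleton_permute (w : Equiv.Perm (Fin n)) (π : Setoid (Fin n)) (y : Fin n) :
    IsSingleton (permute w π) y ↔ IsSingleton π (w⁻¹ y) := by
  constructor
  · intro h z hz
    have := h (w z) (by rw [permute_iff]; simpa using hz)
    simp [← this]
  · intro h z hz
    exact (w⁻¹ : Equiv.Perm (Fin n)).injective (h _ hz)

/-- Permutations act on pairs of sequences, and hence on functions of them. -/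
def Probe.pull (w : Equiv.Perm (Fin n)) (P : Probe n) : Probe n :=
  ⟨P.1, (w⁻¹ : Equiv.Perm (Fin n)) ∘ P.2.1, (w⁻¹ : Equiv.Perm (Fin n)) ∘ P.2.2⟩

theorem admissible_permute (w : Equiv.Perm (Fin n)) (π : Setoid (Fin n)) (P : Probe n) :
    Admissible (permute w π) P ↔ Admissible π (P.pull w) := by
  unfold Admissible
  rw [card_quotient_permute]
  refine and_congr Iff.rfl (Equiv.forall_congr (w⁻¹ : Equiv.Perm (Fin n)) fun y => ?_)
  rw [isSingleton_permute]
  simp [Probe.pull]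

theorem partitionVec_permute (w : Equiv.Perm (Fin n)) (π : Setoid (Fin n)) (P : Probe n) :
    partitionVec (permute w π) P = partitionVec π (P.pull w) := by
  classical
  unfold partitionVec
  rw [admissible_permute]
  rfl

/-! ### Almost noncrossing partitions and their resolutions as recolourings. -/

section Resolution

variable {i : ℕ} {h : i + 1 < n} {π : Setoid (Fin n)}

theorem val_adj (x : Fin n) : (adj i h x : ℕ) =
    if (x : ℕ) = i then i + 1 else if (x : ℕ) = i + 1 then i else x := by
  unfold adj lo up
  rw [Equiv.swap_apply_def]
  simp only [Fin.ext_iff]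
  split_ifs <;> rfl

/-- A crossing that avoids `i` or `i + 1` survives `s_i`, which preserves order away from either
point. So any crossing of `π` uses both points, and the points of a crossing are not singletons. -/
theorem AlmostNoncrossing.not_isSingleton (hπ : AlmostNoncrossing i h π) :
    ¬ IsSingleton π (lo i h) ∧ ¬ IsSingleton π (up i h) := by
  have key : ∀ a b c d : Fin n, a < b → b < c → c < d → π a c → π b d →
      (a ≠ lo i h ∧ b ≠ lo i h ∧ c ≠ lo i h ∧ d ≠ lo i h) ∨
      (a ≠ up i h ∧ b ≠ up i h ∧ c ≠ up i h ∧ d ≠ up i h) → π a b := by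
    intro a b c d hab hbc hcd hac hbd hne
    have mono : ∀ x y : Fin n, x < y → (x ≠ lo i h ∧ y ≠ lo i h) ∨ (x ≠ up i h ∧ y ≠ up i h) →
        adj i h x < adj i h y := by
      intro x y hxy hne
      simp only [Fin.lt_def, val_adj]
      simp only [lo, up, Fin.lt_def, ne_eq, Fin.ext_iff] at hxy hne
      split_ifs <;> omega
    have := hπ.noncrossing (adj i h a) (adj i h b) (adj i h c) (adj i h d)
      (mono a b hab (by tauto)) (mono b c hbc (by tauto)) (mono c d hcd (by tauto))
    simp only [permute_adj_iff] at this
    simp only [adj, Equiv.swap_apply_self] at this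
    exact (this hac hbd).1
  have hcr : ∃ a b c d : Fin n, a < b ∧ b < c ∧ c < d ∧ π a c ∧ π b d ∧ ¬ π a b := by
    by_contra hcon
    push Not at hcon
    refine hπ.crossing fun a b c d h1 h2 h3 h4 h5 => ?_
    have hs := hcon a b c d h1 h2 h3 h4 h5
    exact ⟨hs, π.trans (π.symm hs) h4, π.trans (π.symm h4) (π.trans hs h5)⟩
  obtain ⟨a, b, c, d, hab, hbc, hcd, hac, hbd, hn⟩ := hcr
  have hk := fun h => hn (key a b c d hab hbc hcd hac hbd h)
  have single : ∀ u, IsSingleton π u → a ≠ u ∧ b ≠ u ∧ c ≠ u ∧ d ≠ u := by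
    intro u hu
    refine ⟨?_, ?_, ?_, ?_⟩ <;> rintro rfl
    · exact absurd (hu _ (π.symm hac)) (hab.trans hbc).ne'
    · exact absurd (hu _ (π.symm hbd)) (hbc.trans hcd).ne'
    · exact absurd (hu _ hac) (hab.trans hbc).ne
    · exact absurd (hu _ hbd) (hbc.trans hcd).ne
  exact ⟨fun hs => hk (Or.inl (single _ hs)), fun hs => hk (Or.inr (single _ hs))⟩

variable {k : ℕ} {f : Fin n → Fin k}

theorem res₁_colouring (hπ : AlmostNoncrossing i h π) (hf : ∀ x y, π x y ↔ f x = f y)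
    (x y : Fin n) : res₁ hπ x y ↔
      colour₁ f (lo i h) (up i h) x = colour₁ f (lo i h) (up i h) y := by
  have h0 := lo_ne_up i h
  have hn := hπ.not_rel
  rw [hf] at hn
  unfold res₁ colour₁
  simp only [replaceBlocks_iff, Set.mem_union, Set.mem_sdiff, Set.mem_singleton_iff, mem_block, hf]
  grind

theorem res₂_colouring (hπ : AlmostNoncrossing i h π) (hf : ∀ x y, π x y ↔ f x = f y)
    (x y : Fin n) : res₂ hπ x y ↔
      colour₂ f (lo i h) (up i h) x = colour₂ f (lo i h) (up i h) y := by
  have h0 := lo_ne_up i h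
  have hn := hπ.not_rel
  rw [hf] at hn
  unfold res₂ colour₂
  simp only [replaceBlocks_iff, Set.mem_union, Set.mem_sdiff, Set.mem_singleton_iff,
    Set.mem_insert_iff, mem_block, hf]
  grind

theorem res₃_colouring (hπ : AlmostNoncrossing i h π) (hf : ∀ x y, π x y ↔ f x = f y)
    (x y : Fin n) : res₃ hπ x y ↔
      colour₃ f (lo i h) (up i h) x = colour₃ f (lo i h) (up i h) y := by
  have h0 := lo_ne_up i h
  have hn := hπ.not_rel
  rw [hf] at hn
  unfold res₃ colour₃
  simp only [replaceBlocks_iff, Set.mem_union, Set.mem_sdiff, Set.mem_singleton_iff, mem_block, hf]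
  grind

theorem res₄_colouring (hπ : AlmostNoncrossing i h π) (hf : ∀ x y, π x y ↔ f x = f y)
    (x y : Fin n) : res₄ hπ x y ↔
      colour₃ f (up i h) (lo i h) x = colour₃ f (up i h) (lo i h) y := by
  have h0 := lo_ne_up i h
  have hn := hπ.not_rel
  rw [hf] at hn
  unfold res₄ colour₃
  simp only [replaceBlocks_iff, Set.mem_union, Set.mem_sdiff, Set.mem_singleton_iff, mem_block, hf]
  grind

end Resolution

/-! ### Block counts and singletons under recolouring; the role of the coefficients `ε`. -/

section Colourings

variable {k : ℕ} {π ρ : Setoid (Fin n)} {f g : Fin n → Fin k} {i j a b : Fin n}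

theorem admissible_congr (hπ : ∀ x y, π x y ↔ f x = f y) (hρ : ∀ x y, ρ x y ↔ g x = g y)
    (hf : Function.Surjective f) (hg : Function.Surjective g)
    (hs : ∀ y, (∀ z, g z = g y → z = y) ↔ ∀ z, f z = f y → z = y) (P : Probe n) :
    Admissible ρ P ↔ Admissible π P := by
  unfold Admissible IsSingleton
  simp only [hπ, hρ, hs, card_quotient_of_colouring hf hπ, card_quotient_of_colouring hg hρ]

theorem colour₁_surjective (hf : Function.Surjective f) : Function.Surjective (colour₁ f i j) := by
  intro r
  obtain ⟨z, rfl⟩ := hf r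
  unfold colour₁
  by_cases h1 : z = i
  · exact ⟨j, by grind⟩
  by_cases h2 : z = j
  · exact ⟨i, by grind⟩
  exact ⟨z, by grind⟩

theorem colour₂_surjective (hf : Function.Surjective f) (hij : f i ≠ f j) (hai : a ≠ i)
    (ha : f a = f i) : Function.Surjective (colour₂ f i j) := by
  intro r
  obtain ⟨z, rfl⟩ := hf r
  unfold colour₂
  by_cases h1 : f z = f i
  · exact ⟨a, by grind⟩
  by_cases h2 : f z = f j
  · exact ⟨i, by grind⟩
  exact ⟨z, by grind⟩

theorem colour₃_surjective (hf : Function.Surjective f) (hai : a ≠ i) (ha : f a = f i) :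
    Function.Surjective (colour₃ f i j) := by
  intro r
  obtain ⟨z, rfl⟩ := hf r
  unfold colour₃
  by_cases h1 : z = i
  · exact ⟨a, by grind⟩
  exact ⟨z, by grind⟩

theorem colour₁_singleton (hij : f i ≠ f j) (hai : a ≠ i) (ha : f a = f i) (hbj : b ≠ j)
    (hb : f b = f j) (y : Fin n) :
    (∀ z, colour₁ f i j z = colour₁ f i j y → z = y) ↔ ∀ z, f z = f y → z = y := by
  unfold colour₁
  constructor
  · intro h z
    have h1 := h z
    have h2 := h a
    have h3 := h b
    grind
  · intro h z
    have h1 := h z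
    have h2 := h a
    have h3 := h b
    grind

theorem colour₂_singleton (hij : f i ≠ f j) (hai : a ≠ i) (ha : f a = f i) (hbj : b ≠ j)
    (hb : f b = f j) (y : Fin n) :
    (∀ z, colour₂ f i j z = colour₂ f i j y → z = y) ↔ ∀ z, f z = f y → z = y := by
  unfold colour₂
  constructor
  · intro h z
    have h1 := h z
    have h2 := h a
    have h3 := h b
    have h4 := h i
    have h5 := h j
    grind
  · intro h z
    have h1 := h z
    have h2 := h a
    have h3 := h b
    have h4 := h i
    have h5 := h j
    grind

/-- The second companion `a'` keeps the fibre of `i` from shrinking to the singleton `a` when `i`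
leaves it. -/
theorem colour₃_singleton (hij : f i ≠ f j) {a' : Fin n} (hai : a ≠ i) (ha : f a = f i)
    (hai' : a' ≠ i) (ha' : f a' = f i) (haa : a ≠ a') (hbj : b ≠ j) (hb : f b = f j) (y : Fin n) :
    (∀ z, colour₃ f i j z = colour₃ f i j y → z = y) ↔ ∀ z, f z = f y → z = y := by
  unfold colour₃
  constructor
  · intro h z
    have h1 := h z
    have h2 := h a
    have h3 := h b
    have h4 := h i
    have h5 := h j
    have h6 := h a'
    grind
  · intro h z
    have h1 := h z
    have h2 := h a
    have h3 := h b
    have h4 := h i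
    have h5 := h j
    grind

/-- Once `i` has left, only `a` can have colour `f i`, so a sequence missing `a` has a zero row. -/
theorem probeDet_colour₃_eq_zero {t x : Fin k → Fin n} (hij : f i ≠ f j)
    (hA : ∀ z, f z = f i → z = i ∨ z = a) (ha : (∀ c, t c ≠ a) ∨ ∀ c, x c ≠ a) :
    probeDet t x (colour₃ f i j) = 0 := by
  unfold probeDet
  rcases ha with ha | ha
  · rw [det_incid_eq_zero _ t (f i), zero_mul]
    intro c
    have := hA (t c)
    have := ha c
    unfold colour₃
    grind
  · rw [det_incid_eq_zero _ x (f i), mul_zero]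
    intro c
    have := hA (x c)
    have := ha c
    unfold colour₃
    grind

end Colourings

theorem two_lt_ncard_block_iff {k : ℕ} {π : Setoid (Fin n)} {f : Fin n → Fin k}
    (hf : ∀ x y, π x y ↔ f x = f y) {i a : Fin n} (hai : a ≠ i) (ha : f a = f i) :
    2 < (block π i).ncard ↔ ∃ a', a' ≠ i ∧ f a' = f i ∧ a ≠ a' := by
  constructor
  · intro h
    by_contra hcon
    push Not at hcon
    have hsub : block π i ⊆ (({i, a} : Finset (Fin n)) : Set (Fin n)) := by
      intro z hz
      rw [mem_block, hf] at hz
      have := hcon z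
      simp only [Finset.coe_insert, Finset.coe_singleton, Set.mem_insert_iff,
        Set.mem_singleton_iff]
      grind
    have hle := Set.ncard_le_ncard hsub (Set.toFinite _)
    rw [Set.ncard_coe_finset] at hle
    have := Finset.card_le_two (a := i) (b := a)
    omega
  · rintro ⟨a', hai', ha', haa⟩
    have hsub : (({i, a, a'} : Finset (Fin n)) : Set (Fin n)) ⊆ block π i := by
      intro z hz
      rw [mem_block, hf]
      simp only [Finset.coe_insert, Finset.coe_singleton, Set.mem_insert_iff,
        Set.mem_singleton_iff] at hz
      grind
    have hle := Set.ncard_le_ncard hsub (Set.toFinite _)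
    rw [Set.ncard_coe_finset, Finset.card_eq_three.2 ⟨i, a, a', hai.symm, hai'.symm, haa, rfl⟩]
      at hle
    omega

theorem exists_ne_of_not_isSingleton {k : ℕ} {π : Setoid (Fin n)} {f : Fin n → Fin k}
    (hf : ∀ x y, π x y ↔ f x = f y) {i : Fin n} (hi : ¬ IsSingleton π i) :
    ∃ a, a ≠ i ∧ f a = f i := by
  unfold IsSingleton at hi
  push Not at hi
  obtain ⟨a, h1, h2⟩ := hi
  exact ⟨a, h2, (hf _ _).1 h1⟩

-- Explains `ε`: for a block of size two the determinant is already zero, so dropping the term costs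
-- nothing; for a larger block admissibility is unchanged.
open Classical in
theorem ite_partitionVec_of_colouring {k : ℕ} {π ρ : Setoid (Fin n)} {f : Fin n → Fin k}
    (hf : ∀ x y, π x y ↔ f x = f y) (hs : Function.Surjective f) {i j b : Fin n}
    (hρ : ∀ x y, ρ x y ↔ colour₃ f i j x = colour₃ f i j y) (hij : f i ≠ f j)
    (hi : ¬ IsSingleton π i) (hbj : b ≠ j) (hb : f b = f j) {t x : Fin k → Fin n}
    (hP : Admissible π ⟨k, t, x⟩) :
    (if 2 < (block π i).ncard then partitionVec ρ ⟨k, t, x⟩ else 0) =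
      probeDet t x (colour₃ f i j) := by
  obtain ⟨a, hai, ha⟩ := exists_ne_of_not_isSingleton hf hi
  have hiff := two_lt_ncard_block_iff hf hai ha
  by_cases hA : ∃ a', a' ≠ i ∧ f a' = f i ∧ a ≠ a'
  · rw [if_pos (hiff.2 hA)]
    obtain ⟨a', hai', ha', haa⟩ := hA
    rw [partitionVec_of_colouring hρ, if_pos]
    exact (admissible_congr hf hρ hs (colour₃_surjective hs hai ha)
      (colour₃_singleton hij hai ha hai' ha' haa hbj hb) _).2 hP
  · rw [if_neg (mt hiff.1 hA)]
    push Not at hA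
    have hA' : ∀ z, f z = f i → z = i ∨ z = a := fun z hz => by
      by_contra hcon
      rw [not_or] at hcon
      exact hcon.2 (hA z hcon.1 hz).symm
    rw [probeDet_colour₃_eq_zero hij hA']
    -- The point `a` becomes a singleton only after the resolution; in `π` it is not one, so
    -- admissibility keeps it out of `t` or out of `x`.
    have hns : ¬ IsSingleton π a := fun hsg => hai (hsg i ((hf _ _).2 ha.symm)).symm
    rw [← hP.2] at hns
    simp only [Set.mem_range, not_and_or, not_exists] at hns
    exact hns

/-- The vectors of set partitions satisfy the skein relation. -/
theorem partitionVec_skein {i : ℕ} {h : i + 1 < n} {π : Setoid (Fin n)}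
    (hπ : AlmostNoncrossing i h π) (P : Probe n) :
    partitionVec (res₁ hπ) P + partitionVec (res₂ hπ) P
      - (if 2 < (block π (lo i h)).ncard then partitionVec (res₃ hπ) P else 0)
      - (if 2 < (block π (up i h)).ncard then partitionVec (res₄ hπ) P else 0)
      = - partitionVec π P := by
  classical
  obtain ⟨f, hs, hf⟩ := exists_colouring π
  have hij : f (lo i h) ≠ f (up i h) := fun e => hπ.not_rel ((hf _ _).2 e)
  obtain ⟨h1, h2⟩ := hπ.not_isSingleton
  obtain ⟨a, hai, ha⟩ := exists_ne_of_not_isSingleton hf h1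
  obtain ⟨b, hbj, hb⟩ := exists_ne_of_not_isSingleton hf h2
  have hA1 := admissible_congr hf (res₁_colouring hπ hf) hs (colour₁_surjective hs)
    (colour₁_singleton hij hai ha hbj hb) P
  have hA2 := admissible_congr hf (res₂_colouring hπ hf) hs (colour₂_surjective hs hij hai ha)
    (colour₂_singleton hij hai ha hbj hb) P
  by_cases hP : Admissible π P
  · obtain ⟨k, t, x⟩ := P
    obtain rfl : Nat.card (Quotient π) = k := hP.1
    rw [ite_partitionVec_of_colouring hf hs (res₃_colouring hπ hf) hij h1 hbj hb hP,
      ite_partitionVec_of_colouring hf hs (res₄_colouring hπ hf) hij.symm h2 hai ha hP,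
      partitionVec_of_colouring (res₁_colouring hπ hf), partitionVec_of_colouring
      (res₂_colouring hπ hf), partitionVec_of_colouring hf, if_pos hP, if_pos (hA1.2 hP),
      if_pos (hA2.2 hP)]
    -- This supplies the vanishing hypotheses of the two-row identity at `i` and `i + 1`.
    have hns : ∀ u, ¬ IsSingleton π u → (∀ c, t c ≠ u) ∨ ∀ c, x c ≠ u := by
      intro u hu
      rw [← hP.2] at hu
      simpa only [Set.mem_range, not_and_or, not_exists] using hu
    linear_combination probeDet_skein t x f hij (hns _ h1) (hns _ h2)
  · have hz : ∀ ρ : Setoid (Fin n), ¬ Admissible ρ P → partitionVec ρ P = 0 :=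
      fun ρ hρ => if_neg hρ
    -- At an inadmissible probe every term vanishes: the resolutions that occur have the same
    -- admissible probes as `π`.
    have big : ∀ {u v c : Fin n} {ρ : Setoid (Fin n)}, ¬ IsSingleton π u → f u ≠ f v → c ≠ v →
        f c = f v → (∀ x y, ρ x y ↔ colour₃ f u v x = colour₃ f u v y) →
        (if 2 < (block π u).ncard then partitionVec ρ P else 0) = 0 := by
      intro u v c ρ hu huv hcv hc hρ
      split_ifs with hc2
      · obtain ⟨d, hdu, hd⟩ := exists_ne_of_not_isSingleton hf hu
        obtain ⟨d', hdu', hd', hdd⟩ := (two_lt_ncard_block_iff hf hdu hd).1 hc2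
        exact hz _ fun hA => hP ((admissible_congr hf hρ hs (colour₃_surjective hs hdu hd)
          (colour₃_singleton huv hdu hd hdu' hd' hdd hcv hc) _).1 hA)
      · rfl
    rw [big h1 hij hbj hb (res₃_colouring hπ hf), big h2 hij.symm hai ha (res₄_colouring hπ hf),
      hz _ (fun hA => hP (hA1.1 hA)), hz _ (fun hA => hP (hA2.1 hA)), hz _ hP]
    ring

end Vectors

end Skein
namespace Skein

/-! ### Linear independence of the noncrossing vectors. -/

section Independence

variable {n : ℕ}

/-- `y` is the point of its block where `v` is smallest. -/
def IsLowest (v : Fin n → ℤ) (π : Setoid (Fin n)) (y : Fin n) : Prop := ∀ z, π z y → v y ≤ v z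

open Classical in
/-- The sum of the least values of `v` on the blocks of `π`. -/
noncomputable def lowestSum (v : Fin n → ℤ) (π : Setoid (Fin n)) : ℤ :=
  ∑ y with IsLowest v π y, v y

section Colouring

variable {k : ℕ} {v : Fin n → ℤ} {π : Setoid (Fin n)} {f : Fin n → Fin k}

theorem exists_lowest_points (v : Fin n → ℤ) (hs : Function.Surjective f) :
    ∃ m : Fin k → Fin n, (∀ r, f (m r) = r) ∧ ∀ z, v (m (f z)) ≤ v z := by
  have : ∀ r, ∃ y, f y = r ∧ ∀ z, f z = r → v y ≤ v z := by
    intro r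
    obtain ⟨y, hy, hm⟩ := Finset.exists_min_image (Finset.univ.filter fun z => f z = r) v
      (by obtain ⟨z, hz⟩ := hs r; exact ⟨z, by simpa using hz⟩)
    exact ⟨y, by simpa using hy, fun z hz => hm z (by simpa using hz)⟩
  choose m h1 h2 using this
  exact ⟨m, h1, fun z => h2 _ z rfl⟩

theorem mem_range_lowest_points (hv : Function.Injective v) (hf : ∀ x y, π x y ↔ f x = f y)
    {m : Fin k → Fin n} (h1 : ∀ r, f (m r) = r) (h2 : ∀ z, v (m (f z)) ≤ v z) (y : Fin n) :
    y ∈ Set.range m ↔ IsLowest v π y := by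
  constructor
  · rintro ⟨r, rfl⟩ z hz
    rw [hf, h1] at hz
    exact hz ▸ h2 z
  · intro h
    exact ⟨f y, hv (le_antisymm (h2 y) (h _ ((hf _ _).2 (h1 _))))⟩

theorem lowestSum_eq (hv : Function.Injective v) (hf : ∀ x y, π x y ↔ f x = f y)
    {m : Fin k → Fin n} (h1 : ∀ r, f (m r) = r) (h2 : ∀ z, v (m (f z)) ≤ v z) :
    lowestSum v π = ∑ r, v (m r) := by
  classical
  have hm : Function.Injective m := Function.LeftInverse.injective h1
  rw [← Finset.sum_image (f := v) (g := m) (s := Finset.univ) fun _ _ _ _ h => hm h]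
  unfold lowestSum
  congr 1
  ext y
  rw [Finset.mem_filter_univ, ← mem_range_lowest_points hv hf h1 h2]
  simp

/-- The sequence `u` meets every block once, and replacing each point by the lowest one of its block
can only decrease the sum. As `v` is injective, equality means nothing moved. -/
theorem lowestSum_le (hv : Function.Injective v) (hf : ∀ x y, π x y ↔ f x = f y)
    {u : Fin k → Fin n} (hu : Function.Injective (f ∘ u)) :
    lowestSum v π ≤ ∑ r, v (u r) ∧
      (lowestSum v π = ∑ r, v (u r) → ∀ y, y ∈ Set.range u ↔ IsLowest v π y) := by
  have hb : Function.Bijective (f ∘ u) := Finite.injective_iff_bijective.1 hu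
  have hs : Function.Surjective f := hb.surjective.of_comp
  obtain ⟨m, h1, h2⟩ := exists_lowest_points v hs
  have hsum : lowestSum v π = ∑ r, v (m (f (u r))) := by
    rw [lowestSum_eq hv hf h1 h2]
    exact (hb.sum_comp fun r => v (m r)).symm
  have hle : ∀ r ∈ Finset.univ, v (m (f (u r))) ≤ v (u r) := fun r _ => h2 _
  refine ⟨hsum ▸ Finset.sum_le_sum hle, fun he y => ?_⟩
  rw [hsum, Finset.sum_eq_sum_iff_of_le hle] at he
  rw [← mem_range_lowest_points hv hf h1 h2]
  have hmu : m ∘ (f ∘ u) = u := funext fun r => hv (he r (Finset.mem_univ _))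
  rw [← hmu, hb.surjective.range_comp]

theorem injective_of_det_incid_ne_zero {t : Fin k → Fin n} (h : (incid f t).det ≠ 0) :
    Function.Injective (f ∘ t) := by
  intro c d hcd
  by_contra hne
  refine h (Matrix.det_zero_of_column_eq hne fun r => ?_)
  simp only [Function.comp_apply] at hcd
  simp [incid, hcd]

theorem det_incid_of_section {t : Fin k → Fin n} (h : ∀ r, f (t r) = r) :
    (incid f t).det = 1 := by
  have : incid f t = 1 := by
    ext r c
    simp [incid, h, Matrix.one_apply, eq_comm]
  rw [this, Matrix.det_one]

end Colouring

/-! ### Noncrossing partitions from their block minima and maxima. -/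

section Determined

variable {π ρ : Setoid (Fin n)}

theorem exists_isLowest (v : Fin n → ℤ) (π : Setoid (Fin n)) (x : Fin n) :
    ∃ a, π a x ∧ IsLowest v π a := by
  classical
  obtain ⟨a, ha, hm⟩ := Finset.exists_min_image (Finset.univ.filter fun z => π z x) v
    ⟨x, by simp⟩
  have ha' : π a x := by simpa using ha
  exact ⟨a, ha', fun z hz => hm z (by simpa using π.trans hz ha')⟩

/-- The value of a point, used to detect the minima of blocks. -/
def posVal (y : Fin n) : ℤ := (y : ℕ)

/-- The negated value of a point, used to detect the maxima of blocks. -/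
def negVal (y : Fin n) : ℤ := -((y : ℕ) : ℤ)

theorem posVal_injective : Function.Injective (posVal (n := n)) := fun x y h => by
  simpa [posVal, Fin.ext_iff] using h

theorem negVal_injective : Function.Injective (negVal (n := n)) := fun x y h => by
  simpa [negVal, Fin.ext_iff] using h

theorem posVal_le {x y : Fin n} : posVal x ≤ posVal y ↔ x ≤ y := by
  simp [posVal]

theorem negVal_le {x y : Fin n} : negVal x ≤ negVal y ↔ y ≤ x := by
  simp [negVal]

/-- If `a < b`, then `b`, a minimum for `π` too, is not in the `π`-block of `a` and `x`. Let `y` be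
the maximum of the `π`-block of `b`. If `y < x`, induction puts `y` in the `ρ`-block of `x`, where
it is not maximal; if `y = x`, the two blocks meet; if `x < y`, then `a < b < x < y` cross. -/
theorem not_lt_of_lowest (hπ : Noncrossing π)
    (hX : ∀ y, IsLowest negVal π y → IsLowest negVal ρ y)
    (hT : ∀ y, IsLowest posVal ρ y → IsLowest posVal π y) {x a b : Fin n}
    (ih : ∀ y z, y < z → z < x → (π y z → ρ y z)) (ha : π a x) (hb : ρ b x)
    (hbm : IsLowest posVal ρ b) (hbx : b < x) : ¬ a < b := by
  intro hab
  have hbπ := hT b hbm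
  have hnab : ¬ π a b := fun h => absurd (posVal_le.1 (hbπ a h)) (not_le.2 hab)
  obtain ⟨y, hyb, hy⟩ := exists_isLowest negVal π b
  have hby : b ≤ y := negVal_le.1 (hy b (π.symm hyb))
  rcases lt_trichotomy y x with hyx | rfl | hxy
  · have hρ : ρ b y := by
      rcases hby.eq_or_lt with rfl | h
      · exact ρ.refl _
      · exact ih _ _ h hyx (π.symm hyb)
    exact absurd (negVal_le.1 (hX y hy x (ρ.trans (ρ.symm hb) hρ))) (not_le.2 hyx)
  · exact hnab (π.trans ha hyb)
  · exact hnab (hπ a b x y hab hbx hxy ha (π.symm hyb)).1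

/-- A noncrossing partition is determined by the minima and the maxima of its blocks. -/
theorem Noncrossing.eq_of_lowest (hπ : Noncrossing π) (hρ : Noncrossing ρ)
    (hT : ∀ y, IsLowest posVal π y ↔ IsLowest posVal ρ y)
    (hX : ∀ y, IsLowest negVal π y ↔ IsLowest negVal ρ y) : π = ρ := by
  have step : ∀ {π ρ : Setoid (Fin n)}, Noncrossing π → Noncrossing ρ →
      (∀ y, IsLowest posVal π y ↔ IsLowest posVal ρ y) →
      (∀ y, IsLowest negVal π y ↔ IsLowest negVal ρ y) → ∀ x,
      (∀ y z, y < z → z < x → (π y z ↔ ρ y z)) → ∀ y, y < x → π y x → ρ y x := by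
    intro π ρ hπ hρ hT hX x ih y hyx hy
    obtain ⟨a, ha, ham⟩ := exists_isLowest posVal π x
    obtain ⟨b, hb, hbm⟩ := exists_isLowest posVal ρ x
    have hay : a ≤ y := posVal_le.1 (ham y (π.trans hy (π.symm ha)))
    have hax : a < x := hay.trans_lt hyx
    have hbx : b < x := by
      refine lt_of_le_of_ne (posVal_le.1 (hbm x (ρ.symm hb))) ?_
      rintro rfl
      exact absurd (posVal_le.1 ((hT b).2 hbm a ha)) (not_le.2 hax)
    have h1 := not_lt_of_lowest hπ (fun y => (hX y).1) (fun y => (hT y).2)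
      (fun y z h h' => (ih y z h h').1) ha hb hbm hbx
    have h2 := not_lt_of_lowest hρ (fun y => (hX y).2) (fun y => (hT y).1)
      (fun y z h h' => (ih y z h h').2) hb ha ham hax
    -- The `π`-block and the `ρ`-block of `x` have the same minimum, so `y` is linked to `x` through
    -- it, using only pairs below `x`.
    obtain rfl : a = b := le_antisymm (not_lt.1 h2) (not_lt.1 h1)
    rcases hay.eq_or_lt with rfl | h
    · exact hb
    · exact ρ.trans (ρ.symm ((ih _ _ h hyx).1 (π.trans ha (π.symm hy)))) hb
  have main : ∀ x y, y < x → (π y x ↔ ρ y x) := by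
    intro x
    induction x using WellFoundedLT.induction with
    | ind x ih =>
      intro y hyx
      exact ⟨step hπ hρ hT hX x (fun y z h h' => ih z h' y h) y hyx,
        step hρ hπ (fun y => (hT y).symm) (fun y => (hX y).symm) x
          (fun y z h h' => (ih z h' y h).symm) y hyx⟩
  ext x y
  rcases lt_trichotomy x y with h | rfl | h
  · exact main y x h
  · exact iff_of_true (π.refl _) (ρ.refl _)
  · exact (π.comm'.trans (main x y h)).trans ρ.comm'

end Determined

/-- A weight for which every noncrossing partition has a coordinate vanishing on all other
noncrossing partitions of at least the same weight. -/
noncomputable def blockWeight (π : Setoid (Fin n)) : ℤ := lowestSum posVal π + lowestSum negVal π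

theorem exists_leading_probe {π : Setoid (Fin n)} (hπ : Noncrossing π) :
    ∃ P : Probe n, partitionVec π P = 1 ∧ ∀ ρ, Noncrossing ρ → partitionVec ρ P ≠ 0 →
      blockWeight π ≤ blockWeight ρ → ρ = π := by
  classical
  obtain ⟨f, hs, hf⟩ := exists_colouring π
  obtain ⟨t, t1, t2⟩ := exists_lowest_points posVal hs
  obtain ⟨x, x1, x2⟩ := exists_lowest_points negVal hs
  have ht := mem_range_lowest_points posVal_injective hf t1 t2
  have hx := mem_range_lowest_points negVal_injective hf x1 x2
  refine ⟨⟨_, t, x⟩, ?_, fun ρ hρ hne hw => ?_⟩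
  -- The probe lists the block minima and maxima; a point is both exactly when its block is a
  -- singleton.
  · rw [partitionVec_of_colouring hf, if_pos, probeDet, det_incid_of_section t1,
      det_incid_of_section x1, one_mul]
    refine ⟨rfl, fun y => ?_⟩
    change y ∈ Set.range t ∧ y ∈ Set.range x ↔ _
    rw [ht, hx]
    constructor
    · rintro ⟨h1, h2⟩ z hz
      exact le_antisymm (negVal_le.1 (h2 z hz)) (posVal_le.1 (h1 z hz))
    · intro h
      exact ⟨fun z hz => by rw [h z hz], fun z hz => by rw [h z hz]⟩
  · have hA : Admissible ρ ⟨_, t, x⟩ := by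
      by_contra h
      exact hne (if_neg h)
    obtain ⟨g, -, hg⟩ := exists_colouring ρ
    have hc : Nat.card (Quotient ρ) = Nat.card (Quotient π) := hA.1
    -- Generalising over `g` lets its colour set be rewritten to that of `f`.
    revert g
    rw [hc]
    intro g hg
    rw [partitionVec_of_colouring hg, if_pos hA] at hne
    obtain ⟨l1, e1⟩ := lowestSum_le posVal_injective hg
      (injective_of_det_incid_ne_zero (left_ne_zero_of_mul hne))
    obtain ⟨l2, e2⟩ := lowestSum_le negVal_injective hg
      (injective_of_det_incid_ne_zero (right_ne_zero_of_mul hne))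
    rw [← lowestSum_eq posVal_injective hf t1 t2] at l1 e1
    rw [← lowestSum_eq negVal_injective hf x1 x2] at l2 e2
    unfold blockWeight at hw
    exact hρ.eq_of_lowest hπ (fun y => (e1 (by linarith) y).symm.trans (ht y))
      fun y => (e2 (by linarith) y).symm.trans (hx y)

/-- The linear map sending a noncrossing partition to its vector. -/
noncomputable def skeinMap (n : ℕ) : (NC n →₀ ℂ) →ₗ[ℂ] (Probe n → ℂ) :=
  Finsupp.linearCombination ℂ fun π => partitionVec π.1

theorem skeinMap_basisVec (π : Setoid (Fin n)) (hπ : Noncrossing π) :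
    skeinMap n (basisVec π hπ) = partitionVec π := by
  simp [skeinMap, Finsupp.linearCombination_single]

theorem skeinMap_injective (n : ℕ) : Function.Injective (skeinMap n) := by
  rw [injective_iff_map_eq_zero]
  intro v hv
  by_contra hne
  -- At the leading probe of a support element of least weight, every other term of the support
  -- vanishes.
  obtain ⟨π, hπ, hmin⟩ := Finset.exists_min_image v.support (fun π => blockWeight π.1)
    (Finsupp.support_nonempty_iff.2 hne)
  obtain ⟨P, h1, h2⟩ := exists_leading_probe π.2
  have h := congrFun hv P
  rw [skeinMap, Finsupp.linearCombination_apply, Finsupp.sum, Finset.sum_apply,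
    Finset.sum_eq_single π] at h
  · simp [h1] at h
    exact Finsupp.mem_support_iff.1 hπ h
  · intro ρ hρ hρπ
    by_contra hz
    refine hρπ (Subtype.ext (h2 ρ.1 ρ.2 (fun h0 => hz ?_) (hmin ρ hρ)))
    simp [h0]
  · exact fun h => absurd hπ h

end Independence

end Skein
namespace Skein

/-! ### Transport of the signed action. -/

section Action

variable {n : ℕ}

/-- Both cases of the skein rule become one formula, since crossing partitions have vectors too. -/
theorem skeinMap_adjAct (i : ℕ) (h : i + 1 < n) (π : NC n) :
    skeinMap n (adjAct i h π) = - partitionVec (permute (adj i h) π.1) := by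
  unfold adjAct
  split_ifs with hs
  · rw [map_neg, skeinMap_basisVec]
  · unfold sigma
    simp only [map_add, map_sub, apply_ite (skeinMap n), map_zero, skeinMap_basisVec]
    funext P
    rw [Pi.neg_apply, ← partitionVec_skein (almostNoncrossing_permute i h π hs) P]
    simp only [Pi.add_apply, Pi.sub_apply, apply_ite (fun F : Probe n → ℂ => F P), Pi.zero_apply]

/-- The signed action of permutations on functions on pairs of sequences. -/
def signedPull (w : Equiv.Perm (Fin n)) : Module.End ℂ (Probe n → ℂ) :=
  ((Equiv.Perm.sign w : ℤ) : ℂ) • LinearMap.funLeft ℂ ℂ (Probe.pull w)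

theorem signedPull_apply (w : Equiv.Perm (Fin n)) (F : Probe n → ℂ) (P : Probe n) :
    signedPull w F P = ((Equiv.Perm.sign w : ℤ) : ℂ) * F (P.pull w) := rfl

/-- The signed action of permutations, as a representation. -/
def signedPullRep (n : ℕ) : Representation ℂ (Equiv.Perm (Fin n)) (Probe n → ℂ) where
  toFun := signedPull
  map_one' := by
    ext F P
    simp [signedPull_apply, Probe.pull]
  map_mul' u w := by
    ext F P
    simp only [Module.End.mul_apply, signedPull_apply, Equiv.Perm.sign_mul, Units.val_mul,
      Int.cast_mul, mul_assoc]
    congr 2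

theorem signedPullRep_partitionVec (w : Equiv.Perm (Fin n)) (π : Setoid (Fin n)) :
    signedPullRep n w (partitionVec π) =
      ((Equiv.Perm.sign w : ℤ) : ℂ) • partitionVec (permute w π) := by
  funext P
  exact (signedPull_apply w _ P).trans (by rw [Pi.smul_apply, partitionVec_permute, smul_eq_mul])

theorem signedPullRep_adj (i : ℕ) (h : i + 1 < n) (π : NC n) :
    signedPullRep n (adj i h) (skeinMap n (basisVec π.1 π.2)) = skeinMap n (adjAct i h π) := by
  rw [skeinMap_basisVec, signedPullRep_partitionVec, skeinMap_adjAct, adj,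
    Equiv.Perm.sign_swap (lo_ne_up i h)]
  simp

theorem perm_induction {p : Equiv.Perm (Fin n) → Prop} (h1 : p 1)
    (hmul : ∀ u w, p u → p w → p (u * w)) (hadj : ∀ i (h : i + 1 < n), p (adj i h))
    (w : Equiv.Perm (Fin n)) : p w := by
  cases n with
  | zero => exact Subsingleton.elim 1 w ▸ h1
  | succ m =>
    have hw : w ∈ Submonoid.closure
        (Set.range fun i : Fin m => Equiv.swap i.castSucc i.succ) := by
      rw [Equiv.Perm.mclosure_swap_castSucc_succ]
      trivial
    induction hw using Submonoid.closure_induction with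
    | mem x hx =>
      obtain ⟨i, rfl⟩ := hx
      exact hadj i (by omega)
    | one => exact h1
    | mul x y _ _ hx hy => exact hmul x y hx hy

theorem IsSkeinAction.skeinMap_comm {ρ : Representation ℂ (Equiv.Perm (Fin n)) (NC n →₀ ℂ)}
    (hρ : IsSkeinAction ρ) (w : Equiv.Perm (Fin n)) (v : NC n →₀ ℂ) :
    skeinMap n (ρ w v) = signedPullRep n w (skeinMap n v) := by
  induction w using perm_induction generalizing v with
  | h1 => simp
  | hmul u w hu hw => simp [hu, hw]
  | hadj i h =>
    suffices hs : skeinMap n ∘ₗ ρ (adj i h) = signedPullRep n (adj i h) ∘ₗ skeinMap n from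
      LinearMap.congr_fun hs v
    refine Finsupp.lhom_ext' fun π => LinearMap.ext_ring ?_
    have := signedPullRep_adj i h π
    rw [← hρ i h π] at this
    exact this.symm

/-- Stability of the range, checked on adjacent transpositions, makes it a subrepresentation. -/
theorem signedPullRep_mem_range (w : Equiv.Perm (Fin n)) (v : NC n →₀ ℂ) :
    ∃ u, skeinMap n u = signedPullRep n w (skeinMap n v) := by
  induction w using perm_induction generalizing v with
  | h1 => exact ⟨v, by simp⟩
  | hmul u w hu hw =>
    obtain ⟨a, ha⟩ := hw v
    obtain ⟨b, hb⟩ := hu a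
    exact ⟨b, by rw [hb, ha, map_mul, Module.End.mul_apply]⟩
  | hadj i h =>
    refine ⟨Finsupp.linearCombination ℂ (adjAct i h) v, ?_⟩
    suffices hs : skeinMap n ∘ₗ Finsupp.linearCombination ℂ (adjAct i h) =
        signedPullRep n (adj i h) ∘ₗ skeinMap n from LinearMap.congr_fun hs v
    refine Finsupp.lhom_ext' fun π => LinearMap.ext_ring ?_
    have := signedPullRep_adj i h π
    simpa using this.symm

theorem exists_isSkeinAction (n : ℕ) :
    ∃ ρ : Representation ℂ (Equiv.Perm (Fin n)) (NC n →₀ ℂ), IsSkeinAction ρ := by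
  have hinj := skeinMap_injective n
  -- Any linear left inverse will do: it is applied only to vectors in the range.
  obtain ⟨ψ, hψ⟩ := (skeinMap n).exists_leftInverse_of_injective (LinearMap.ker_eq_bot.2 hinj)
  have hcomm : ∀ w v, skeinMap n (ψ (signedPullRep n w (skeinMap n v))) =
      signedPullRep n w (skeinMap n v) := by
    intro w v
    obtain ⟨u, hu⟩ := signedPullRep_mem_range w v
    rw [← hu]
    exact congrArg _ (LinearMap.congr_fun hψ u)
  refine ⟨{ toFun := fun w => ψ ∘ₗ signedPullRep n w ∘ₗ skeinMap n
            map_one' := ?_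
            map_mul' := fun u w => ?_ }, fun i h π => hinj ?_⟩
  · refine LinearMap.ext fun v => hinj ?_
    refine (hcomm 1 v).trans ?_
    simp
  · refine LinearMap.ext fun v => hinj ?_
    refine (hcomm (u * w) v).trans ?_
    rw [map_mul, Module.End.mul_apply, ← hcomm w v]
    exact (hcomm u _).symm
  · exact (hcomm _ _).trans (signedPullRep_adj i h π)

/-! ### The long element and the long cycle. -/

theorem Noncrossing.permute_revPerm {π : Setoid (Fin n)} (hπ : Noncrossing π) :
    Noncrossing (permute Fin.revPerm π) := by
  intro a b c d hab hbc hcd hac hbd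
  have h := hπ d.rev c.rev b.rev a.rev (Fin.rev_lt_rev.2 hcd) (Fin.rev_lt_rev.2 hbc)
    (Fin.rev_lt_rev.2 hab) (π.symm hbd) (π.symm hac)
  exact ⟨π.symm h.2.2, π.symm h.2.1, π.symm h.1⟩

theorem Noncrossing.permute_finRotate {m : ℕ} {π : Setoid (Fin (m + 1))} (hπ : Noncrossing π) :
    Noncrossing (permute (finRotate (m + 1)) π) := by
  have key : ∀ a b : Fin (m + 1), a < b →
      ((finRotate (m + 1))⁻¹ b : ℕ) + 1 = b := by
    intro a b hab
    have hb : b ≠ 0 := (Fin.zero_le a).trans_lt hab |>.ne'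
    have := coe_finRotate_symm_of_ne_zero hb
    have h0 : (b : ℕ) ≠ 0 := fun h => hb (Fin.ext h)
    rw [Equiv.Perm.inv_def, this]
    omega
  intro a b c d hab hbc hcd hac hbd
  simp only [permute_iff] at *
  have kb := key a b hab
  have kc := key b c hbc
  have kd := key c d hcd
  suffices hs : π ((finRotate (m + 1))⁻¹ a) ((finRotate (m + 1))⁻¹ b) from
    ⟨hs, π.trans (π.symm hs) hac, π.trans (π.symm hac) (π.trans hs hbd)⟩
  rw [Fin.lt_def] at hab hbc hcd
  -- The inverse rotation lowers nonzero points by one and sends `0` to the last point, so for `a =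
  -- 0` the four points are read in the cyclic order `b, c, d, a`.
  by_cases ha : a = 0
  · have ka : ((finRotate (m + 1))⁻¹ a : Fin (m + 1)) = Fin.last m := by
      rw [Equiv.Perm.inv_eq_iff_eq, finRotate_last, ha]
    have hd := d.isLt
    have h := hπ ((finRotate (m + 1))⁻¹ b) ((finRotate (m + 1))⁻¹ c) ((finRotate (m + 1))⁻¹ d)
      ((finRotate (m + 1))⁻¹ a) (by rw [Fin.lt_def]; omega) (by rw [Fin.lt_def]; omega)
      (by rw [ka, Fin.lt_def, Fin.val_last]; omega) hbd (π.symm hac)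
    exact π.symm (π.trans hbd h.2.2)
  · have ka := key 0 a (Fin.pos_of_ne_zero ha)
    exact (hπ _ _ _ _ (by rw [Fin.lt_def]; omega) (by rw [Fin.lt_def]; omega)
      (by rw [Fin.lt_def]; omega) hac hbd).1

theorem sign_revPerm (n : ℕ) :
    Equiv.Perm.sign (Fin.revPerm : Equiv.Perm (Fin n)) = (-1) ^ n.choose 2 := by
  -- Every pair is an inversion, and `j` is the larger member of `j` pairs.
  rw [Equiv.Perm.sign_eq_prod_prod_Iio]
  have h : ∀ j : Fin n, (∏ i ∈ Finset.Iio j,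
      (if (Fin.revPerm i : Fin n) < Fin.revPerm j then (1 : ℤˣ) else -1)) = (-1) ^ (j : ℕ) := by
    intro j
    rw [Finset.prod_congr rfl (g := fun _ => (-1 : ℤˣ)) fun i hi => ?_]
    · rw [Finset.prod_const, Fin.card_Iio]
    · rw [Finset.mem_Iio] at hi
      simp [Fin.rev_lt_rev, hi.le]
  rw [Finset.prod_congr rfl fun j _ => h j, Finset.prod_pow_eq_pow_sum,
    Fin.sum_univ_eq_sum_range (fun i => i) n, Finset.sum_range_id, Nat.choose_two_right]

theorem IsSkeinAction.apply_basisVec {ρ : Representation ℂ (Equiv.Perm (Fin n)) (NC n →₀ ℂ)}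
    (hρ : IsSkeinAction ρ) (w : Equiv.Perm (Fin n)) (π : NC n)
    (hw : Noncrossing (permute w π.1)) :
    ρ w (basisVec π.1 π.2) =
      ((Equiv.Perm.sign w : ℤ) : ℂ) • basisVec (permute w π.1) hw := by
  apply skeinMap_injective n
  rw [hρ.skeinMap_comm, skeinMap_basisVec, signedPullRep_partitionVec, map_smul, skeinMap_basisVec]

end Action

end Skein

theorem corollary6p5 (n : ℕ) :
    (∃! ρ : Representation ℂ (Equiv.Perm (Fin n)) (Skein.NC n →₀ ℂ), Skein.IsSkeinAction ρ) ∧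
    ∀ ρ : Representation ℂ (Equiv.Perm (Fin n)) (Skein.NC n →₀ ℂ), Skein.IsSkeinAction ρ →
      (∀ (w : Equiv.Perm (Fin n)) (π : Skein.NC n)
        (hw : Skein.Noncrossing (Skein.permute w π.1)),
        ρ w (Skein.basisVec π.1 π.2) =
          ((Equiv.Perm.sign w : ℤ) : ℂ) • Skein.basisVec (Skein.permute w π.1) hw) ∧
      (∀ π : Skein.NC n, ∃ h0 : Skein.Noncrossing (Skein.permute Fin.revPerm π.1),
        ρ Fin.revPerm (Skein.basisVec π.1 π.2) =
          ((-1 : ℂ) ^ n.choose 2) • Skein.basisVec (Skein.permute Fin.revPerm π.1) h0) ∧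
      (1 ≤ n → ∀ π : Skein.NC n, ∃ hc : Skein.Noncrossing (Skein.permute (finRotate n) π.1),
        ρ (finRotate n) (Skein.basisVec π.1 π.2) =
          ((-1 : ℂ) ^ (n - 1)) • Skein.basisVec (Skein.permute (finRotate n) π.1) hc) := by
  refine ⟨?_, fun ρ hρ => ⟨fun w π hw => hρ.apply_basisVec w π hw, fun π => ?_, fun hn π => ?_⟩⟩
  · obtain ⟨ρ, hρ⟩ := Skein.exists_isSkeinAction n
    refine ⟨ρ, hρ, fun τ hτ => MonoidHom.ext fun w => LinearMap.ext fun v => ?_⟩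
    exact Skein.skeinMap_injective n ((hτ.skeinMap_comm w v).trans (hρ.skeinMap_comm w v).symm)
  · refine ⟨π.2.permute_revPerm, ?_⟩
    rw [hρ.apply_basisVec _ π π.2.permute_revPerm, Skein.sign_revPerm]
    simp
  · obtain ⟨m, rfl⟩ := Nat.exists_eq_add_of_le' hn
    refine ⟨π.2.permute_finRotate, ?_⟩
    rw [hρ.apply_basisVec _ π π.2.permute_finRotate, sign_finRotate]
    simp
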